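/- **Theorem (Consistency of Meta-KGL).** Let $\phi_j:\mathcal X\to\mathbb R^{d_j}$, $j=1,\dots,p$, be feature maps on a set $\mathcal X$ whose kernels $k_j(x,x')=\phi_j(x)^\top\phi_j(x')$ satisfy $k_j\le 1$ on $\mathcal X\times\mathcal X$, and let $J^\star\subset\{1,\dots,p\}$. For $m\ge1$ tasks with $n$ samples each, at fixed inputs $x_{s,i}\in\mathcal X$, one observes $$y_{s,i}=f_s(x_{s,i})+\varepsilon_{s,i},\qquad f_s=\sum_{j=1}^p\phi_j^\top\beta_s^{\star(j)},\qquad s\le m,\ i\le n,$$ where $\beta_s^{\star(j)}=0$ for $j\notin J^\star$, and the $\varepsilon_{s,i}$ are i.i.d., centred and sub-Gaussian with variance proxy $\sigma^2$, i.e. $\mathbb E\,e^{t\varepsilon_{s,i}}\le e^{\sigma^2t^2/2}$ for all $t\in\mathbb R$ ($\sigma>0$). For $\beta=(\beta_s^{(j)})_{s\le m,\,j\le p}$ with $\beta_s^{(j)}\in\mathbb R^{d_j}$ put $\|\beta^{(j)}\|_2=\big(\sum_{s}\|\beta_s^{(j)}\|_2^2\big)^{1/2}$ and $(\Phi\beta)_{s,i}=\sum_j\phi_j(x_{s,i})^\top\beta_s^{(j)}$.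 Suppose that, with constants $c_1,c_\kappa>0$: * (beta-min) $\|\beta^{\star(j)}\|_2\ge c_1\sqrt m$ for all $j\in J^\star$; * (compatibility) $\kappa(\Phi)\ge c_\kappa$, where $$\kappa(\Phi)=\inf_{(J,b)}\frac1{\sqrt n}\,\frac{\|\Phi b\|_2}{\sum_{j\in J}\|b^{(j)}\|_2},$$ the infimum being over all $J\subset\{1,\dots,p\}$ with $|J|\le|J^\star|$ and all $b\neq0$ in $\mathbb R^{m(d_1+\dots+d_p)}$ with $\sum_{j\notin J}\|b^{(j)}\|_2\le3\sum_{j\in J}\|b^{(j)}\|_2$. Let $\omega\in(0,c_1)$, $\bar\omega=\min\{\omega,c_1-\omega\}$ and $\lambda=\bar\omega c_\kappa^2/(8\sqrt m)$. Let $\hat\beta$ be any minimizer of the group lasso loss $$\frac1{mn}\sum_{s=1}^m\sum_{i=1}^n\big(y_{s,i}-(\Phi\beta)_{s,i}\big)^2+\lambda\sum_{j=1}^p\|\beta^{(j)}\|_2,$$ and let $\hat J=\{j:\|\hat\beta^{(j)}\|_2>\omega\sqrt m\}$. If $\sqrt n>32\sigma/(\bar\omega c_\kappa^2)$, then $$\mathbb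 P[\hat J=J^\star]\ \ge\ 1-p\exp\!\Big(-\frac m2\Big(\frac{\bar\omega c_\kappa^2\sqrt n}{32\sigma}-1\Big)^2\Big).$$ In particular, $\hat J$ is consistent in $n$ and in $m$. Keep the feature maps, $J^\star$, $\sigma$, $c_1$, $c_\kappa$ and $\omega$ fixed. Then: (i) for fixed $m\ge1$ and any sequence, indexed by $n$, of such data sets which satisfy the assumptions above for all large $n$, $\lim_{n\to\infty}\mathbb P[\hat J=J^\star]=1$; (ii) for fixed $n$ with $\sqrt n>32\sigma/(\bar\omega c_\kappa^2)$ and any sequence, indexed by $m$, of such data sets which satisfy the assumptions above for all large $m$, $\lim_{m\to\infty}\mathbb P[\hat J=J^\star]=1$. -/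

import Mathlib

open MeasureTheory ProbabilityTheory Filter Topology
open scoped ENNReal

namespace MetaKGL

/-- Coefficients `β ∈ ℝ^{md}`, `d = ∑ j, d j`: the entry `β s j ∈ ℝ^{d j}` belongs to
task `s` and base kernel `j`. -/
abbrev Coeff (m : ℕ) {p : ℕ} (d : Fin p → ℕ) : Type :=
  Fin m → (j : Fin p) → EuclideanSpace ℝ (Fin (d j))

/-- The Euclidean norm of the group `β^{(j)} = [β_1^{(j)}, …, β_m^{(j)}] ∈ ℝ^{m d_j}`. -/
noncomputable def groupNorm {m p : ℕ} {d : Fin p → ℕ} (β : Coeff m d) (j : Fin p) : ℝ :=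
  Real.sqrt (∑ s : Fin m, ‖β s j‖ ^ 2)

/-- The base kernel `k_j(x, x') = φ_j(x)ᵀ φ_j(x')`. -/
noncomputable def baseKernel {X : Type*} {p : ℕ} {d : Fin p → ℕ}
    (φ : (j : Fin p) → X → EuclideanSpace ℝ (Fin (d j))) (j : Fin p) (x x' : X) : ℝ :=
  inner ℝ (φ j x) (φ j x')

/-- The function `x ↦ φ(x)ᵀ b = ∑ j, φ_j(x)ᵀ b^{(j)}`. -/
noncomputable def linFun {X : Type*} {p : ℕ} {d : Fin p → ℕ}
    (φ : (j : Fin p) → X → EuclideanSpace ℝ (Fin (d j)))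
    (b : (j : Fin p) → EuclideanSpace ℝ (Fin (d j))) (x : X) : ℝ :=
  ∑ j : Fin p, inner ℝ (φ j x) (b j)

/-- The vector `Φ β ∈ ℝ^{mn}`, where `Φ = diag(Φ_1, …, Φ_m)` and `Φ_s` is the `n × d` matrix
with rows `φ(x_{s,i})ᵀ`. -/
noncomputable def design {X : Type*} {m n p : ℕ} {d : Fin p → ℕ}
    (φ : (j : Fin p) → X → EuclideanSpace ℝ (Fin (d j))) (x : Fin m → Fin n → X)
    (β : Coeff m d) (s : Fin m) (i : Fin n) : ℝ :=
  linFun φ (β s) (x s i)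

/-- The group lasso loss
`(1 / (m n)) ‖y - Φ β‖₂² + lam ∑ j, ‖β^{(j)}‖₂`. -/
noncomputable def loss {X : Type*} {m n p : ℕ} {d : Fin p → ℕ}
    (φ : (j : Fin p) → X → EuclideanSpace ℝ (Fin (d j))) (x : Fin m → Fin n → X)
    (y : Fin m → Fin n → ℝ) (lam : ℝ) (β : Coeff m d) : ℝ :=
  (1 / ((m : ℝ) * (n : ℝ))) * ∑ s : Fin m, ∑ i : Fin n, (y s i - design φ x β s i) ^ 2
    + lam * ∑ j : Fin p, groupNorm β j

/-- The thresholded support `{j | ‖β^{(j)}‖₂ > ω √m}`. -/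
noncomputable def selected {m p : ℕ} {d : Fin p → ℕ} (ω : ℝ) (β : Coeff m d) :
    Finset (Fin p) :=
  Finset.univ.filter (fun j => ω * Real.sqrt (m : ℝ) < groupNorm β j)

/-- The compatibility variable `κ(Φ)` for sparsity level `r`: the infimum of
`(1 / √n) ‖Φ b‖₂ / ∑_{j ∈ J} ‖b^{(j)}‖₂` over all `J` with at most `r` elements and all
`b ≠ 0` with `∑_{j ∉ J} ‖b^{(j)}‖₂ ≤ 3 ∑_{j ∈ J} ‖b^{(j)}‖₂`.
The denominator is positive on this set; an infimum over the empty set (`r = 0`) is `∞`. -/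
noncomputable def kappa {X : Type*} {m n p : ℕ} {d : Fin p → ℕ}
    (φ : (j : Fin p) → X → EuclideanSpace ℝ (Fin (d j))) (x : Fin m → Fin n → X) (r : ℕ) :
    ℝ≥0∞ :=
  ⨅ (J : Finset (Fin p)) (b : Coeff m d) (_ : J.card ≤ r) (_ : b ≠ 0)
    (_ : ∑ j ∈ Jᶜ, groupNorm b j ≤ 3 * ∑ j ∈ J, groupNorm b j),
    ENNReal.ofReal ((1 / Real.sqrt (n : ℝ)) *
      (Real.sqrt (∑ s : Fin m, ∑ i : Fin n, design φ x b s i ^ 2) / ∑ j ∈ J, groupNorm b j))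

/-- The regularization parameter `min{ω, c₁ - ω} cκ² / (8 √m)`. -/
noncomputable def reg (m : ℕ) (c₁ cκ ω : ℝ) : ℝ :=
  min ω (c₁ - ω) * cκ ^ 2 / (8 * Real.sqrt (m : ℝ))

/-- The random variables `ε s i` are independent, identically distributed, centred and
sub-Gaussian with variance proxy `σ²`, that is, `E exp(t ε) ≤ exp(σ² t² / 2)` for all `t`. -/
structure IsNoise {Ω : Type*} [MeasurableSpace Ω] (μ : Measure Ω) (σ : ℝ) {m n : ℕ}
    (ε : Fin m → Fin n → Ω → ℝ) : Prop where
  measurable : ∀ s i, Measurable (ε s i)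
  indep : iIndepFun (fun k : Fin m × Fin n => ε k.1 k.2) μ
  ident : ∀ s i s' i', IdentDistrib (ε s i) (ε s' i') μ μ
  mean_zero : ∀ s i, ∫ w, ε s i w ∂μ = 0
  subGaussian : ∀ s i, HasSubgaussianMGF (ε s i) (Real.toNNReal (σ ^ 2)) μ

/-- The setting with `m` tasks and `n` samples per task at fixed inputs `x`: rewards
`y_{s,i} = f_s(x_{s,i}) + ε_{s,i}` with `f_s = φᵀ β*_s`, whose coefficients vanish outside `J*`;
the beta-min condition with constant `c₁`; sufficiently informative data with constant `cκ`;
and `βhat`, a minimizer of the loss of the observed rewards. -/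
structure Setting {X : Type*} {p : ℕ} {d : Fin p → ℕ}
    (φ : (j : Fin p) → X → EuclideanSpace ℝ (Fin (d j))) (Jstar : Finset (Fin p))
    (σ c₁ cκ ω : ℝ) {m n : ℕ} {Ω : Type*} [MeasurableSpace Ω] (μ : Measure Ω)
    (βstar : Coeff m d) (x : Fin m → Fin n → X) (ε : Fin m → Fin n → Ω → ℝ)
    (βhat : Ω → Coeff m d) : Prop where
  prob : IsProbabilityMeasure μ
  noise : IsNoise μ σ ε
  support : ∀ s, ∀ j ∉ Jstar, βstar s j = 0
  betaMin : ∀ j ∈ Jstar, c₁ * Real.sqrt (m : ℝ) ≤ groupNorm βstar j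
  informative : ENNReal.ofReal cκ ≤ kappa φ x Jstar.card
  argmin : ∀ w : Ω, ∀ β : Coeff m d,
    loss φ x (fun s i => linFun φ (βstar s) (x s i) + ε s i w) (reg m c₁ cκ ω) (βhat w) ≤
      loss φ x (fun s i => linFun φ (βstar s) (x s i) + ε s i w) (reg m c₁ cκ ω) β

end MetaKGL

/-! Let `Z_j² = ∑ s, ‖∑ i, ε s i • φ j (x s i)‖²` be the correlation of the noise with group `j`.
The proof separates a deterministic claim from a tail bound. Deterministically, if every `Z_j ≤ lam
m n / 4`, comparing the loss at `βhat` and `βstar` puts the error in the compatibility cone, and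
compatibility bounds the sum of its group norms by `2 lam m / cκ²` (`sum_groupNorm_sub_le`). For the
given `lam` this is a quarter of the threshold margin `min ω (c₁ - ω) √m`, so thresholding finds
`Jstar` (`selected_eq`). For the tail, `exp (‖V‖² / 2)` is the Gaussian average of `exp ⟪V, g⟫`.
After Tonelli, the noise enters linearly and its sub-Gaussian bound applies; a Gaussian integral
remains. Hence an exponential moment of at most `(1 - θ)^(-m/2)`, independent of the dimensions `d
j` (`IsNoise.lintegral_exp_sq_norm_le`). Chernoff's method and a union bound over the `p` groups
conclude. -/

namespace MetaKGL

/-! ### Gaussian integrals -/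

section Gaussian

variable {E : Type*} [NormedAddCommGroup E] [InnerProductSpace ℝ E] [FiniteDimensional ℝ E]
  [MeasurableSpace E] [BorelSpace E]

lemma stdGaussian_map_inner (v : E) :
    (stdGaussian E).map (fun g => inner ℝ v g) = gaussianReal 0 (‖v‖ ^ 2).toNNReal := by
  have h := IsGaussian.map_eq_gaussianReal (μ := stdGaussian E) (innerSL ℝ v)
  rw [integral_strongDual_stdGaussian, variance_dual_stdGaussian, innerSL_apply_norm] at h
  exact h

/-- Read from right to left, this linearizes the exponential of a squared norm. -/
lemma lintegral_stdGaussian_exp_inner (v : E) :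
    ∫⁻ g, ENNReal.ofReal (Real.exp (inner ℝ v g)) ∂stdGaussian E
      = ENNReal.ofReal (Real.exp (‖v‖ ^ 2 / 2)) := by
  have h : ∫⁻ x, ENNReal.ofReal (Real.exp (1 * x)) ∂gaussianReal 0 (‖v‖ ^ 2).toNNReal
      = ENNReal.ofReal (Real.exp (‖v‖ ^ 2 / 2)) := by
    rw [← ofReal_integral_eq_lintegral_ofReal (integrable_exp_mul_gaussianReal 1)
      (ae_of_all _ fun _ => (Real.exp_pos _).le)]
    have := mgf_gaussianReal (p := gaussianReal 0 (‖v‖ ^ 2).toNNReal) (X := id)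
      (Measure.map_id) 1
    rw [mgf] at this
    simp only [id] at this
    rw [this, Real.coe_toNNReal _ (sq_nonneg _)]
    simp
  rw [← stdGaussian_map_inner v, lintegral_map (by fun_prop) (by fun_prop)] at h
  simpa using h

lemma lintegral_gaussianReal_exp_sq {s : ℝ} (hs : s < 1) :
    ∫⁻ x, ENNReal.ofReal (Real.exp (s / 2 * x ^ 2)) ∂gaussianReal 0 1
      = ENNReal.ofReal (√(1 - s))⁻¹ := by
  have hb : 0 < (1 - s) / 2 := by linarith
  rw [gaussianReal_of_var_ne_zero _ one_ne_zero,
    lintegral_withDensity_eq_lintegral_mul _ (measurable_gaussianPDF _ _) (by fun_prop)]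
  have h : ∀ x : ℝ, (gaussianPDF 0 1 * fun x => ENNReal.ofReal (Real.exp (s / 2 * x ^ 2))) x
      = ENNReal.ofReal ((√(2 * Real.pi))⁻¹ * Real.exp (-((1 - s) / 2) * x ^ 2)) := by
    intro x
    rw [Pi.mul_apply, gaussianPDF, ← ENNReal.ofReal_mul (gaussianPDFReal_nonneg _ _ _),
      gaussianPDFReal, mul_assoc, ← Real.exp_add]
    congr 2
    · simp
    · congr 1
      simp
      ring
  simp_rw [h]
  rw [← ofReal_integral_eq_lintegral_ofReal ((integrable_exp_neg_mul_sq hb).const_mul _)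
    (ae_of_all _ fun _ => by positivity), integral_const_mul, integral_gaussian]
  congr 1
  rw [← Real.sqrt_inv, ← Real.sqrt_inv, ← Real.sqrt_mul (by positivity)]
  congr 1
  have : 1 - s ≠ 0 := by linarith
  field_simp

lemma lintegral_stdGaussian_exp_inner_sq_le {s : ℝ} (hs0 : 0 ≤ s) (hs : s < 1) {v : E}
    (hv : ‖v‖ ≤ 1) :
    ∫⁻ g, ENNReal.ofReal (Real.exp (s / 2 * inner ℝ v g ^ 2)) ∂stdGaussian E
      ≤ ENNReal.ofReal (√(1 - s))⁻¹ := by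
  have hmap : (gaussianReal 0 1).map (fun x => ‖v‖ * x) = gaussianReal 0 (‖v‖ ^ 2).toNNReal := by
    rw [gaussianReal_map_const_mul]
    congr 1
    · simp
    · ext; simp
  have h : ∫⁻ g, ENNReal.ofReal (Real.exp (s / 2 * inner ℝ v g ^ 2)) ∂stdGaussian E
      = ∫⁻ x, ENNReal.ofReal (Real.exp (s / 2 * (‖v‖ * x) ^ 2)) ∂gaussianReal 0 1 := by
    rw [← lintegral_map (f := fun x => ENNReal.ofReal (Real.exp (s / 2 * x ^ 2)))
      (g := fun g => inner ℝ v g) (by fun_prop) (by fun_prop), stdGaussian_map_inner, ← hmap,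
      lintegral_map (by fun_prop) (by fun_prop)]
  rw [h, ← lintegral_gaussianReal_exp_sq hs]
  refine lintegral_mono fun x => ENNReal.ofReal_le_ofReal (Real.exp_le_exp.2 ?_)
  have : (‖v‖ * x) ^ 2 ≤ x ^ 2 := by
    rw [mul_pow]
    exact mul_le_of_le_one_left (sq_nonneg _) (pow_le_one₀ (norm_nonneg _) hv)
  gcongr

/-- Jensen's inequality with weights `1 / n` reduces to a single direction, so the correlations
between the `⟪v i, g⟫` play no role. -/
lemma lintegral_stdGaussian_exp_sum_inner_sq_le {n : ℕ} (hn : 0 < n) {s : ℝ} (hs0 : 0 ≤ s)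
    (hs : s < 1) {v : Fin n → E} (hv : ∀ i, ‖v i‖ ≤ 1) :
    ∫⁻ g, ENNReal.ofReal (Real.exp (s / (2 * n) * ∑ i, inner ℝ (v i) g ^ 2)) ∂stdGaussian E
      ≤ ENNReal.ofReal (√(1 - s))⁻¹ := by
  have hn' : (0 : ℝ) < n := by exact_mod_cast hn
  have key : ∀ g : E, Real.exp (s / (2 * n) * ∑ i, inner ℝ (v i) g ^ 2)
      ≤ ∑ i, (n : ℝ)⁻¹ * Real.exp (s / 2 * inner ℝ (v i) g ^ 2) := by
    intro g
    have := convexOn_exp.map_sum_le (t := Finset.univ) (w := fun _ : Fin n => (n : ℝ)⁻¹)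
      (p := fun i => s / 2 * inner ℝ (v i) g ^ 2) (fun _ _ => by positivity)
      (by simp [hn'.ne']) (fun _ _ => Set.mem_univ _)
    simp only [smul_eq_mul] at this
    refine le_trans (le_of_eq ?_) this
    rw [Finset.mul_sum]
    congr 1
    refine Finset.sum_congr rfl fun i _ => ?_
    field_simp
  calc _ ≤ ∫⁻ g, ∑ i, ENNReal.ofReal (n : ℝ)⁻¹ *
        ENNReal.ofReal (Real.exp (s / 2 * inner ℝ (v i) g ^ 2)) ∂stdGaussian E := by
        refine lintegral_mono fun g => ?_
        refine (ENNReal.ofReal_le_ofReal (key g)).trans (le_of_eq ?_)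
        rw [ENNReal.ofReal_sum_of_nonneg fun _ _ => by positivity]
        exact Finset.sum_congr rfl fun i _ => ENNReal.ofReal_mul (by positivity)
    _ = ∑ i, ENNReal.ofReal (n : ℝ)⁻¹ * ∫⁻ g,
        ENNReal.ofReal (Real.exp (s / 2 * inner ℝ (v i) g ^ 2)) ∂stdGaussian E := by
        rw [lintegral_finsetSum _ (fun i _ => by fun_prop)]
        exact Finset.sum_congr rfl fun i _ => lintegral_const_mul _ (by fun_prop)
    _ ≤ ∑ _i : Fin n, ENNReal.ofReal (n : ℝ)⁻¹ * ENNReal.ofReal (√(1 - s))⁻¹ := by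
        gcongr with i
        exact lintegral_stdGaussian_exp_inner_sq_le hs0 hs (hv i)
    _ = ENNReal.ofReal (√(1 - s))⁻¹ := by
        rw [Finset.sum_const, Finset.card_univ, Fintype.card_fin, nsmul_eq_mul, ← mul_assoc,
          ← ENNReal.ofReal_natCast, ← ENNReal.ofReal_mul hn'.le, mul_inv_cancel₀ hn'.ne']
        simp

lemma lintegral_pi_prod {ι : Type*} [Fintype ι] {F : Type*} [MeasurableSpace F] (ν : Measure F)
    [IsProbabilityMeasure ν] {f : ι → F → ℝ≥0∞} (hf : ∀ i, Measurable (f i)) :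
    ∫⁻ x, ∏ i, f i (x i) ∂Measure.pi (fun _ : ι => ν) = ∏ i, ∫⁻ y, f i y ∂ν := by
  rw [lintegral_prod_eq_prod_lintegral_of_indepFun Finset.univ (fun i (x : ι → F) => f i (x i))
    (iIndepFun_pi fun i => (hf i).aemeasurable) fun i => (hf i).comp (measurable_pi_apply i)]
  refine Finset.prod_congr rfl fun i _ => ?_
  exact (measurePreserving_eval (fun _ : ι => ν) i).lintegral_comp (hf i)

lemma ofReal_exp_sum {ι : Type*} (s : Finset ι) (f : ι → ℝ) :
    ENNReal.ofReal (Real.exp (∑ i ∈ s, f i)) = ∏ i ∈ s, ENNReal.ofReal (Real.exp (f i)) := by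
  rw [Real.exp_sum, ENNReal.ofReal_prod_of_nonneg fun _ _ => (Real.exp_pos _).le]

end Gaussian

/-! ### Exponential moments and tails of the noise -/

section Noise

variable {Ω : Type*} [MeasurableSpace Ω] {μ : Measure Ω}

lemma IsNoise.lintegral_exp_linear_le {σ : ℝ} {m n : ℕ} {ε : Fin m → Fin n → Ω → ℝ}
    (hε : IsNoise μ σ ε) (a : Fin m → Fin n → ℝ) :
    ∫⁻ w, ENNReal.ofReal (Real.exp (∑ s, ∑ i, a s i * ε s i w)) ∂μ
      ≤ ENNReal.ofReal (Real.exp (σ ^ 2 / 2 * ∑ s, ∑ i, a s i ^ 2)) := by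
  have hind : iIndepFun (fun (k : Fin m × Fin n) w => a k.1 k.2 * ε k.1 k.2 w) μ :=
    hε.indep.comp (fun k x => a k.1 k.2 * x) (fun k => by fun_prop)
  have hk : ∀ k ∈ (Finset.univ : Finset (Fin m × Fin n)), HasSubgaussianMGF
      (fun w => a k.1 k.2 * ε k.1 k.2 w) (Real.toNNReal (a k.1 k.2 ^ 2 * σ ^ 2)) μ := by
    intro k _
    convert (hε.subGaussian k.1 k.2).const_mul (a k.1 k.2) using 1
    rw [Real.toNNReal_mul (sq_nonneg _)]
    congr 1
    exact Real.toNNReal_of_nonneg (sq_nonneg _)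
  have h := HasSubgaussianMGF.sum_of_iIndepFun hind hk
  have hi := h.integrable_exp_mul 1
  have hm := h.mgf_le 1
  rw [mgf] at hm
  simp only [one_mul, Fintype.sum_prod_type] at hi hm
  rw [← ofReal_integral_eq_lintegral_ofReal hi (ae_of_all _ fun _ => (Real.exp_pos _).le)]
  refine ENNReal.ofReal_le_ofReal (hm.trans (le_of_eq ?_))
  congr 1
  have hc : ∀ s i, ((Real.toNNReal (a s i ^ 2 * σ ^ 2) : NNReal) : ℝ) = a s i ^ 2 * σ ^ 2 :=
    fun s i => Real.coe_toNNReal _ (by positivity)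
  simp only [NNReal.coe_sum, hc, ← Finset.sum_mul]
  ring

/-- The exponential moment of a sub-Gaussian quadratic form, by Gaussian decoupling. -/
lemma IsNoise.lintegral_exp_sq_norm_le {E : Type*} [NormedAddCommGroup E] [InnerProductSpace ℝ E]
    [FiniteDimensional ℝ E] [MeasurableSpace E] [BorelSpace E] {σ : ℝ} (hσ : 0 < σ) {m n : ℕ}
    (hn : 0 < n) {ε : Fin m → Fin n → Ω → ℝ} (hε : IsNoise μ σ ε) [IsProbabilityMeasure μ]
    {v : Fin m → Fin n → E} (hv : ∀ s i, ‖v s i‖ ≤ 1) {θ : ℝ} (hθ0 : 0 ≤ θ) (hθ : θ < 1) :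
    ∫⁻ w, ENNReal.ofReal (Real.exp (θ / (2 * σ ^ 2 * n) *
        ∑ s, ‖∑ i, ε s i w • v s i‖ ^ 2)) ∂μ
      ≤ ENNReal.ofReal (√(1 - θ))⁻¹ ^ m := by
  have hn' : (0 : ℝ) < n := by exact_mod_cast hn
  -- With this scaling `‖V s‖² / 2` is the summand of the exponent, and `σ²` cancels once the noise
  -- is integrated out.
  set c : ℝ := √(θ / (σ ^ 2 * n)) with hc
  have hc2 : c ^ 2 = θ / (σ ^ 2 * n) := Real.sq_sqrt (by positivity)
  have hmeas := hε.measurable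
  set V : Fin m → Ω → E := fun s w => c • ∑ i, ε s i w • v s i with hV
  have hVm : ∀ s, Measurable (V s) := fun s => by
    simp only [hV]
    fun_prop
  have h1 : ∀ w, ENNReal.ofReal (Real.exp (θ / (2 * σ ^ 2 * n) *
        ∑ s, ‖∑ i, ε s i w • v s i‖ ^ 2))
      = ∫⁻ g, ∏ s, ENNReal.ofReal (Real.exp (inner ℝ (V s w) (g s)))
          ∂Measure.pi (fun _ : Fin m => stdGaussian E) := by
    intro w
    rw [lintegral_pi_prod (stdGaussian E)
      (f := fun s g => ENNReal.ofReal (Real.exp (inner ℝ (V s w) g))) (fun s => by fun_prop)]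
    simp_rw [lintegral_stdGaussian_exp_inner]
    rw [← ofReal_exp_sum, Finset.mul_sum]
    congr 2
    refine Finset.sum_congr rfl fun s _ => ?_
    rw [hV]
    simp only [norm_smul, mul_pow, Real.norm_eq_abs, sq_abs, hc2]
    field_simp
  have h2 : ∀ g : Fin m → E, ∫⁻ w, ∏ s, ENNReal.ofReal (Real.exp (inner ℝ (V s w) (g s))) ∂μ
      ≤ ∏ s, ENNReal.ofReal (Real.exp (θ / (2 * n) * ∑ i, inner ℝ (v s i) (g s) ^ 2)) := by
    intro g
    have := hε.lintegral_exp_linear_le (fun s i => c * inner ℝ (v s i) (g s))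
    rw [← ofReal_exp_sum]
    simp_rw [← ofReal_exp_sum]
    refine (le_of_eq (lintegral_congr fun w => ?_)).trans (this.trans (le_of_eq ?_))
    · congr 2
      refine Finset.sum_congr rfl fun s _ => ?_
      simp only [hV, inner_smul_left, sum_inner, Finset.mul_sum]
      refine Finset.sum_congr rfl fun i _ => ?_
      simp
      ring
    · congr 2
      simp only [mul_pow, hc2, Finset.mul_sum]
      refine Finset.sum_congr rfl fun s _ => Finset.sum_congr rfl fun i _ => ?_
      field_simp
  calc _ = ∫⁻ w, ∫⁻ g, ∏ s, ENNReal.ofReal (Real.exp (inner ℝ (V s w) (g s)))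
          ∂Measure.pi (fun _ : Fin m => stdGaussian E) ∂μ := lintegral_congr h1
    _ = ∫⁻ g, ∫⁻ w, ∏ s, ENNReal.ofReal (Real.exp (inner ℝ (V s w) (g s))) ∂μ
          ∂Measure.pi (fun _ : Fin m => stdGaussian E) := by
        refine lintegral_lintegral_swap (Measurable.aemeasurable ?_)
        refine Finset.measurable_prod _ fun s _ => ?_
        refine ENNReal.measurable_ofReal.comp (Real.measurable_exp.comp ?_)
        exact ((hVm s).comp measurable_fst).inner ((measurable_pi_apply s).comp measurable_snd)
    _ ≤ ∫⁻ g, ∏ s, ENNReal.ofReal (Real.exp (θ / (2 * n) * ∑ i, inner ℝ (v s i) (g s) ^ 2))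
          ∂Measure.pi (fun _ : Fin m => stdGaussian E) := lintegral_mono h2
    _ = ∏ s, ∫⁻ g, ENNReal.ofReal (Real.exp (θ / (2 * n) * ∑ i, inner ℝ (v s i) g ^ 2))
          ∂stdGaussian E := lintegral_pi_prod (stdGaussian E)
            (f := fun s g => ENNReal.ofReal (Real.exp (θ / (2 * n) * ∑ i, inner ℝ (v s i) g ^ 2)))
            (fun s => by fun_prop)
    _ ≤ ∏ _s : Fin m, ENNReal.ofReal (√(1 - θ))⁻¹ :=
        Finset.prod_le_prod' fun s _ =>
          lintegral_stdGaussian_exp_sum_inner_sq_le hn hθ0 hθ (hv s)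
    _ = _ := by simp

/-- A tail bound for the norm of a sub-Gaussian vector whose covariance has trace at most
`σ² m n` and is block diagonal. -/
lemma IsNoise.measure_sq_norm_gt_le {E : Type*} [NormedAddCommGroup E] [InnerProductSpace ℝ E]
    [FiniteDimensional ℝ E] [MeasurableSpace E] [BorelSpace E] {σ : ℝ} (hσ : 0 < σ) {m n : ℕ}
    (hn : 0 < n) {ε : Fin m → Fin n → Ω → ℝ} (hε : IsNoise μ σ ε) [IsProbabilityMeasure μ]
    {v : Fin m → Fin n → E} (hv : ∀ s i, ‖v s i‖ ≤ 1) {r : ℝ} (hr : 1 < r) :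
    μ.real {w | r ^ 2 * (σ ^ 2 * (m * n)) < ∑ s, ‖∑ i, ε s i w • v s i‖ ^ 2}
      ≤ Real.exp (-((m : ℝ) / 2) * (r - 1) ^ 2) := by
  have hn' : (0 : ℝ) < n := by exact_mod_cast hn
  have hr0 : 0 < r := by linarith
  -- The minimizer over `θ` of the Chernoff bound `(1 - θ)^(-m/2) exp (-θ m r² / 2)`.
  set θ : ℝ := 1 - (r ^ 2)⁻¹ with hθdef
  have hθ0 : 0 ≤ θ := by
    have : (r ^ 2)⁻¹ ≤ 1 := inv_le_one_of_one_le₀ (by nlinarith)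
    linarith
  have hθ : θ < 1 := by
    have : 0 < (r ^ 2)⁻¹ := by positivity
    linarith
  have hsq : (√(1 - θ))⁻¹ = r := by
    rw [hθdef, sub_sub_cancel, Real.sqrt_inv, inv_inv, Real.sqrt_sq hr0.le]
  have hlint := hε.lintegral_exp_sq_norm_le hσ hn hv hθ0 hθ
  rw [hsq, ← ENNReal.ofReal_pow hr0.le] at hlint
  set T : Ω → ℝ := fun w => ∑ s, ‖∑ i, ε s i w • v s i‖ ^ 2 with hT
  have hmeas := hε.measurable
  have hTm : Measurable T := by
    simp only [hT]
    fun_prop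
  set A : ℝ := Real.exp (θ / 2 * (r ^ 2 * m)) with hA
  have hA0 : 0 < A := Real.exp_pos _
  have hmarkov : ENNReal.ofReal A * μ {w | r ^ 2 * (σ ^ 2 * (m * n)) < T w}
      ≤ ENNReal.ofReal (r ^ m) := by
    refine le_trans ?_ hlint
    refine le_trans (mul_le_mul_right (measure_mono ?_) _) (mul_meas_ge_le_lintegral (by fun_prop) _)
    intro w hw
    refine ENNReal.ofReal_le_ofReal (Real.exp_le_exp.2 ?_)
    have hw' : r ^ 2 * (σ ^ 2 * (m * n)) ≤ T w := le_of_lt hw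
    calc θ / 2 * (r ^ 2 * m) = θ / (2 * σ ^ 2 * n) * (r ^ 2 * (σ ^ 2 * (m * n))) := by
          field_simp
      _ ≤ _ := by gcongr
  have hreal : A * μ.real {w | r ^ 2 * (σ ^ 2 * (m * n)) < T w} ≤ r ^ m := by
    have := ENNReal.toReal_mono ENNReal.ofReal_ne_top hmarkov
    rwa [ENNReal.toReal_mul, ENNReal.toReal_ofReal hA0.le,
      ENNReal.toReal_ofReal (by positivity)] at this
  have hlog : Real.log r ≤ r - 1 := Real.log_le_sub_one_of_pos hr0
  have hbound : r ^ m ≤ A * Real.exp (-((m : ℝ) / 2) * (r - 1) ^ 2) := by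
    rw [hA, ← Real.exp_add, ← Real.exp_log (pow_pos hr0 m), Real.log_pow]
    refine Real.exp_le_exp.2 ?_
    have : θ * r ^ 2 = r ^ 2 - 1 := by rw [hθdef]; field_simp
    calc (m : ℝ) * Real.log r ≤ m * (r - 1) := by gcongr
      _ = (θ * r ^ 2) / 2 * m + -((m : ℝ) / 2) * (r - 1) ^ 2 := by rw [this]; ring
      _ = _ := by ring
  exact le_of_mul_le_mul_left (hreal.trans hbound) hA0

end Noise

/-! ### Group norms as Euclidean norms -/

section GroupNorm

variable {m p : ℕ} {d : Fin p → ℕ}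

/-- The group `β^{(j)}` as a vector of a Euclidean space. -/
noncomputable def groupVec (β : Coeff m d) (j : Fin p) :
    PiLp 2 (fun _ : Fin m => EuclideanSpace ℝ (Fin (d j))) :=
  WithLp.toLp 2 (fun s => β s j)

lemma groupNorm_eq_norm (β : Coeff m d) (j : Fin p) : groupNorm β j = ‖groupVec β j‖ := by
  rw [PiLp.norm_eq_of_L2, groupNorm]
  rfl

lemma groupNorm_nonneg (β : Coeff m d) (j : Fin p) : 0 ≤ groupNorm β j := Real.sqrt_nonneg _

lemma groupNorm_le_add_sub (β γ : Coeff m d) (j : Fin p) :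
    groupNorm β j ≤ groupNorm γ j + groupNorm (β - γ) j := by
  simp only [groupNorm_eq_norm]
  have : groupVec (β - γ) j = groupVec β j - groupVec γ j := rfl
  rw [this]
  exact norm_le_norm_add_norm_sub' (groupVec β j) (groupVec γ j)

lemma groupNorm_sub_comm (β γ : Coeff m d) (j : Fin p) :
    groupNorm (β - γ) j = groupNorm (γ - β) j := by
  simp only [groupNorm_eq_norm]
  exact norm_sub_rev (groupVec β j) (groupVec γ j)

lemma groupNorm_eq_zero_of_forall {β : Coeff m d} {j : Fin p} (h : ∀ s, β s j = 0) :
    groupNorm β j = 0 := by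
  simp [groupNorm, h]

lemma sum_groupNorm_pos {β : Coeff m d} (hβ : β ≠ 0) : 0 < ∑ j, groupNorm β j := by
  obtain ⟨s, hs⟩ := Function.ne_iff.1 hβ
  obtain ⟨j, hj⟩ := Function.ne_iff.1 hs
  refine Finset.sum_pos' (fun j _ => groupNorm_nonneg β j) ⟨j, Finset.mem_univ _, ?_⟩
  refine Real.sqrt_pos.2 (Finset.sum_pos' (fun _ _ => by positivity) ⟨s, Finset.mem_univ _, ?_⟩)
  have : 0 < ‖β s j‖ := norm_pos_iff.2 hj
  positivity

lemma sum_inner_le_mul_groupNorm (β : Coeff m d) (j : Fin p)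
    (u : Fin m → EuclideanSpace ℝ (Fin (d j))) :
    ∑ s, inner ℝ (u s) (β s j) ≤ √(∑ s, ‖u s‖ ^ 2) * groupNorm β j := by
  have h := real_inner_le_norm (WithLp.toLp 2 u : PiLp 2 fun _ : Fin m =>
    EuclideanSpace ℝ (Fin (d j))) (groupVec β j)
  rw [PiLp.inner_apply, ← groupNorm_eq_norm, PiLp.norm_eq_of_L2] at h
  exact h

end GroupNorm

/-! ### Oracle inequality and thresholding -/

section Deterministic

variable {X : Type*} {m n p : ℕ} {d : Fin p → ℕ}
  {φ : (j : Fin p) → X → EuclideanSpace ℝ (Fin (d j))} {x : Fin m → Fin n → X}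

lemma design_sub (β γ : Coeff m d) (s : Fin m) (i : Fin n) :
    design φ x (β - γ) s i = design φ x β s i - design φ x γ s i := by
  simp only [design, linFun, ← Finset.sum_sub_distrib]
  exact Finset.sum_congr rfl fun j _ => inner_sub_right _ _ _

/-- Cauchy–Schwarz in each group; this identifies the noise level that the penalty has to dominate.
-/
lemma sum_mul_design_le (e : Fin m → Fin n → ℝ) (β : Coeff m d) :
    ∑ s, ∑ i, e s i * design φ x β s i
      ≤ ∑ j, √(∑ s, ‖∑ i, e s i • φ j (x s i)‖ ^ 2) * groupNorm β j := by
  calc ∑ s, ∑ i, e s i * design φ x β s i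
      = ∑ s, ∑ j, inner ℝ (∑ i, e s i • φ j (x s i)) (β s j) := by
        refine Finset.sum_congr rfl fun s _ => ?_
        simp only [design, linFun, Finset.mul_sum, sum_inner, real_inner_smul_left]
        exact Finset.sum_comm
    _ = ∑ j, ∑ s, inner ℝ (∑ i, e s i • φ j (x s i)) (β s j) := Finset.sum_comm
    _ ≤ _ := Finset.sum_le_sum fun j _ => sum_inner_le_mul_groupNorm β j _

/-- The compatibility condition bounds the groups in `J` of a vector in the cone. -/
lemma mul_sum_groupNorm_le_of_kappa {r : ℕ} {cκ : ℝ} (hn : 0 < n)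
    (hκ : ENNReal.ofReal cκ ≤ kappa φ x r) {J : Finset (Fin p)} (hJ : J.card ≤ r)
    {b : Coeff m d} (hb : ∑ j ∈ Jᶜ, groupNorm b j ≤ 3 * ∑ j ∈ J, groupNorm b j) :
    cκ * √n * ∑ j ∈ J, groupNorm b j ≤ √(∑ s, ∑ i, design φ x b s i ^ 2) := by
  have hn' : (0 : ℝ) < √n := Real.sqrt_pos.2 (by exact_mod_cast hn)
  rcases eq_or_ne b 0 with rfl | hb0
  · have : ∀ j, groupNorm (0 : Coeff m d) j = 0 := fun j =>
      groupNorm_eq_zero_of_forall fun _ => rfl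
    simp only [this, Finset.sum_const_zero, mul_zero]
    exact Real.sqrt_nonneg _
  -- In the cone, a vanishing sum over `J` would force every group of `b` to vanish.
  · have hpos : 0 < ∑ j ∈ J, groupNorm b j := by
      have h1 := sum_groupNorm_pos hb0
      rw [← Finset.sum_add_sum_compl J] at h1
      linarith
    have h := hκ.trans (iInf₂_le_of_le J b (iInf₂_le_of_le hJ hb0 (iInf_le _ hb)))
    rw [ENNReal.ofReal_le_ofReal_iff (by positivity), one_div, inv_mul_eq_div, div_div,
      le_div_iff₀ (by positivity)] at h
    linarith

/-- The oracle inequality for the group lasso on the event that the penalty dominates the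
noise. -/
lemma sum_groupNorm_sub_le {y e : Fin m → Fin n → ℝ} {lam cκ : ℝ} {J : Finset (Fin p)}
    {β βs : Coeff m d} (hm : 0 < m) (hn : 0 < n) (hlam : 0 < lam) (hcκ : 0 < cκ)
    (hy : ∀ s i, y s i = design φ x βs s i + e s i)
    (hsupp : ∀ s, ∀ j ∉ J, βs s j = 0)
    (hκ : ENNReal.ofReal cκ ≤ kappa φ x J.card)
    (hmin : loss φ x y lam β ≤ loss φ x y lam βs)
    (he : ∀ j, √(∑ s, ‖∑ i, e s i • φ j (x s i)‖ ^ 2) ≤ lam * (m * n) / 4) :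
    ∑ j, groupNorm (β - βs) j ≤ 2 * lam * m / cκ ^ 2 := by
  have hm' : (0 : ℝ) < m := by exact_mod_cast hm
  have hn' : (0 : ℝ) < n := by exact_mod_cast hn
  set b : Coeff m d := β - βs with hb
  set Q : ℝ := ∑ s, ∑ i, design φ x b s i ^ 2 with hQ
  have hQ0 : 0 ≤ Q := Finset.sum_nonneg fun _ _ => Finset.sum_nonneg fun _ _ => sq_nonneg _
  set N : ℝ := ∑ s, ∑ i, e s i * design φ x b s i with hN
  set S : ℝ := ∑ j ∈ J, groupNorm b j with hS
  set S' : ℝ := ∑ j ∈ Jᶜ, groupNorm b j with hS'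
  have hS0 : 0 ≤ S := Finset.sum_nonneg fun j _ => groupNorm_nonneg b j
  have htot : ∑ j, groupNorm b j = S + S' := (Finset.sum_add_sum_compl J _).symm
  have hNle : N ≤ lam * (m * n) / 4 * (S + S') := by
    refine (sum_mul_design_le e b).trans ?_
    rw [← htot, Finset.mul_sum]
    exact Finset.sum_le_sum fun j _ => mul_le_mul_of_nonneg_right (he j) (groupNorm_nonneg b j)
  have hsq : ∑ s, ∑ i, (y s i - design φ x β s i) ^ 2
      = ∑ s, ∑ i, (y s i - design φ x βs s i) ^ 2 - 2 * N + Q := by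
    simp only [hN, hQ, Finset.mul_sum, ← Finset.sum_sub_distrib, ← Finset.sum_add_distrib]
    refine Finset.sum_congr rfl fun s _ => Finset.sum_congr rfl fun i _ => ?_
    rw [hb, design_sub, hy]
    ring
  -- Triangle inequality on `J`; off `J` the groups of `b` and `β` coincide, since `βs` vanishes
  -- there.
  have hpen : ∑ j, groupNorm βs j ≤ ∑ j, groupNorm β j + S - S' := by
    rw [← Finset.sum_add_sum_compl J (groupNorm βs), ← Finset.sum_add_sum_compl J (groupNorm β)]
    have h1 : ∑ j ∈ J, groupNorm βs j ≤ ∑ j ∈ J, groupNorm β j + S := by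
      rw [hS, ← Finset.sum_add_distrib]
      refine Finset.sum_le_sum fun j _ => ?_
      rw [hb, groupNorm_sub_comm]
      exact groupNorm_le_add_sub _ _ _
    have h2 : ∑ j ∈ Jᶜ, groupNorm βs j = 0 := Finset.sum_eq_zero fun j hj =>
      groupNorm_eq_zero_of_forall fun s => hsupp s j (Finset.mem_compl.1 hj)
    have h3 : S' = ∑ j ∈ Jᶜ, groupNorm β j := Finset.sum_congr rfl fun j hj => by
      have : ∀ s, βs s j = 0 := fun s => hsupp s j (Finset.mem_compl.1 hj)
      simp [groupNorm, hb, this]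
    linarith
  have hbasic : Q ≤ 2 * N + m * n * lam * (S - S') := by
    have h := hmin
    rw [loss, loss, hsq] at h
    have h4 := mul_le_mul_of_nonneg_left hpen hlam.le
    have h5 : 1 / ((m : ℝ) * n) * (Q - 2 * N) ≤ lam * (S - S') := by linarith
    rw [one_div, inv_mul_le_iff₀ (by positivity)] at h5
    linarith
  -- The noise costs at most half of `m n lam (S + S')`. Doubling `hbasic` and adding one more copy
  -- of this quantity leaves only `S` on the right; dropping `Q` then gives the cone.
  have hmain : 2 * Q + m * n * lam * (S + S') ≤ 4 * (m * n * lam * S) := by linarith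
  have hL : 0 < m * n * lam := by positivity
  have hcone : S' ≤ 3 * S := by
    have : m * n * lam * (S + S') ≤ m * n * lam * (4 * S) := by linarith
    linarith [le_of_mul_le_mul_left this hL]
  have hcomp := mul_sum_groupNorm_le_of_kappa hn hκ le_rfl hcone
  have hR : √Q ^ 2 = Q := Real.sq_sqrt hQ0
  have hn2 : √(n : ℝ) ^ 2 = n := Real.sq_sqrt hn'.le
  have hcomp2 : cκ ^ 2 * n * S ^ 2 ≤ Q := by
    have h0 : 0 ≤ cκ * √n * S := by positivity
    calc cκ ^ 2 * n * S ^ 2 = (cκ * √n * S) ^ 2 := by rw [mul_pow, mul_pow, hn2]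
      _ ≤ √Q ^ 2 := pow_le_pow_left₀ h0 hcomp 2
      _ = Q := hR
  -- Young's inequality
  have hyoung : 4 * (m * n * lam * S) ≤ 2 * (cκ ^ 2 * n * S ^ 2)
      + m * n * lam * (2 * lam * m / cκ ^ 2) := by
    have hid : 2 * (cκ ^ 2 * n * S ^ 2) + m * n * lam * (2 * lam * m / cκ ^ 2)
        - 4 * (m * n * lam * S) = 2 * n * (cκ * S - m * lam / cκ) ^ 2 := by
      field_simp
      ring
    have : 0 ≤ 2 * n * (cκ * S - m * lam / cκ) ^ 2 := by positivity
    linarith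
  -- Compatibility absorbs the quadratic term of `hyoung` into `2 * Q`, which cancels in `hmain`.
  rw [htot]
  refine le_of_mul_le_mul_left ?_ hL
  linarith

/-- Thresholding recovers the support when every group is estimated with error less than the
margin of the threshold. -/
lemma selected_eq {ω c₁ : ℝ} {J : Finset (Fin p)} {β βs : Coeff m d}
    (hsupp : ∀ s, ∀ j ∉ J, βs s j = 0)
    (hmin : ∀ j ∈ J, c₁ * √m ≤ groupNorm βs j)
    (herr : ∀ j, groupNorm (β - βs) j < min ω (c₁ - ω) * √m) :
    selected ω β = J := by
  have hm0 : 0 ≤ √(m : ℝ) := Real.sqrt_nonneg _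
  ext j
  simp only [selected, Finset.mem_filter, Finset.mem_univ, true_and]
  have h := herr j
  constructor
  · intro hj
    by_contra hJ
    have h0 : groupNorm βs j = 0 := groupNorm_eq_zero_of_forall fun s => hsupp s j hJ
    have h1 := groupNorm_le_add_sub β βs j
    have h2 := mul_le_mul_of_nonneg_right (min_le_left ω (c₁ - ω)) hm0
    linarith
  · intro hj
    have h1 := groupNorm_le_add_sub βs β j
    rw [groupNorm_sub_comm] at h1
    have h2 := mul_le_mul_of_nonneg_right (min_le_right ω (c₁ - ω)) hm0
    have h3 := hmin j hj
    linarith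

end Deterministic

/-! ### Finite-sample bound -/

lemma norm_le_one_of_baseKernel_le_one {X : Type*} {p : ℕ} {d : Fin p → ℕ}
    {φ : (j : Fin p) → X → EuclideanSpace ℝ (Fin (d j))}
    (hφ : ∀ (j : Fin p) (x x' : X), baseKernel φ j x x' ≤ 1) (j : Fin p) (x : X) :
    ‖φ j x‖ ≤ 1 := by
  have h := hφ j x x
  rw [baseKernel, real_inner_self_eq_norm_sq] at h
  exact (sq_le_one_iff₀ (norm_nonneg _)).1 h

/-- The finite-sample bound for the recovery of the support. -/
lemma Setting.le_measureReal_selected_eq {X : Type*} {p : ℕ} {d : Fin p → ℕ}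
    {φ : (j : Fin p) → X → EuclideanSpace ℝ (Fin (d j))}
    (hφ : ∀ (j : Fin p) (x x' : X), baseKernel φ j x x' ≤ 1)
    {Jstar : Finset (Fin p)} {σ c₁ cκ ω : ℝ}
    (hσ : 0 < σ) (hκ : 0 < cκ) (hω : ω ∈ Set.Ioo 0 c₁) {m n : ℕ} (hm : 0 < m)
    (hn : 32 * σ / (min ω (c₁ - ω) * cκ ^ 2) < √n) {Ω : Type*} [MeasurableSpace Ω]
    {μ : Measure Ω} {βstar : Coeff m d} {x : Fin m → Fin n → X} {ε : Fin m → Fin n → Ω → ℝ}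
    {βhat : Ω → Coeff m d} (h : Setting φ Jstar σ c₁ cκ ω μ βstar x ε βhat) :
    1 - (p : ℝ) * Real.exp (-((m : ℝ) / 2) *
        (min ω (c₁ - ω) * cκ ^ 2 * √n / (32 * σ) - 1) ^ 2)
      ≤ μ.real {w | selected ω (βhat w) = Jstar} := by
  have := h.prob
  have hm' : (0 : ℝ) < m := by exact_mod_cast hm
  have hω0 : 0 < min ω (c₁ - ω) := lt_min hω.1 (sub_pos.2 hω.2)
  set ω' := min ω (c₁ - ω) with hω'
  have hsn : 0 < √(n : ℝ) := lt_of_le_of_lt (by positivity) hn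
  have hn' : (0 : ℝ) < n := Real.sqrt_pos.1 hsn
  have hn0 : 0 < n := by exact_mod_cast hn'
  have hsm : 0 < √(m : ℝ) := Real.sqrt_pos.2 hm'
  have hm2 : √(m : ℝ) ^ 2 = m := Real.sq_sqrt hm'.le
  have hn2 : √(n : ℝ) ^ 2 = n := Real.sq_sqrt hn'.le
  -- Solves `r σ √(m n) = lam m n / 4`, so that the tail event `B j` is exactly where the noise
  -- exceeds the penalty level.
  set r : ℝ := ω' * cκ ^ 2 * √n / (32 * σ) with hr
  have hr1 : 1 < r := by
    rw [hr, one_lt_div (by positivity)]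
    rw [div_lt_iff₀ (by positivity)] at hn
    linarith
  set B : Fin p → Set Ω := fun j => {w | r ^ 2 * (σ ^ 2 * (m * n)) <
    ∑ s, ‖∑ i, ε s i w • φ j (x s i)‖ ^ 2} with hB
  have hlam : 0 < reg m c₁ cκ ω := by rw [reg]; positivity
  have hgood : (⋃ j, B j)ᶜ ⊆ {w | selected ω (βhat w) = Jstar} := by
    intro w hw
    simp only [hB, Set.mem_compl_iff, Set.mem_iUnion, Set.mem_ofPred_eq, not_exists, not_lt] at hw
    refine selected_eq h.support h.betaMin fun j => ?_
    have hev : ∀ j, √(∑ s, ‖∑ i, ε s i w • φ j (x s i)‖ ^ 2)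
        ≤ reg m c₁ cκ ω * (m * n) / 4 := by
      intro j
      refine Real.sqrt_le_iff.2 ⟨by positivity, (hw j).trans (le_of_eq ?_)⟩
      rw [hr, reg, ← hω', ← hm2, ← hn2]
      simp only [Real.sqrt_sq hsm.le, Real.sqrt_sq hsn.le]
      field_simp
      norm_num
    have hsum := sum_groupNorm_sub_le hm hn0 hlam hκ (fun _ _ => rfl) h.support h.informative
      (h.argmin w (βstar)) hev
    have hj := (Finset.single_le_sum (f := groupNorm (βhat w - βstar))
      (fun j _ => groupNorm_nonneg _ j) (Finset.mem_univ j)).trans hsum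
    refine hj.trans_lt ?_
    have : 2 * reg m c₁ cκ ω * m / cκ ^ 2 = ω' * √m / 4 := by
      rw [reg, ← hω']
      nth_rewrite 2 [← hm2]
      field_simp
      norm_num
    rw [this]
    have : 0 < ω' * √m := by positivity
    linarith
  -- Only the noise events need to be measurable: `βhat` is an arbitrary selection of minimizers,
  -- and the event of recovery is reached by monotonicity.
  have hBm : ∀ j, MeasurableSet (B j) := by
    intro j
    have hmeas := h.noise.measurable
    exact measurableSet_lt (by fun_prop) (by fun_prop)
  have hBle : μ.real (⋃ j, B j) ≤ p * Real.exp (-((m : ℝ) / 2) * (r - 1) ^ 2) := by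
    refine (measureReal_iUnion_fintype_le B).trans ?_
    refine (Finset.sum_le_sum fun j _ => h.noise.measure_sq_norm_gt_le hσ hn0
      (fun s i => norm_le_one_of_baseKernel_le_one hφ j (x s i)) hr1).trans (le_of_eq ?_)
    simp
  have hcompl := probReal_compl_eq_one_sub (μ := μ) (MeasurableSet.iUnion hBm)
  have hmono := measureReal_mono (μ := μ) hgood
  linarith

end MetaKGL

/-! ### The theorem and consistency in `n` and `m` -/

theorem mainTheorem2 {X : Type*} {p : ℕ} {d : Fin p → ℕ}
    (φ : (j : Fin p) → X → EuclideanSpace ℝ (Fin (d j)))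
    (hφ : ∀ (j : Fin p) (x x' : X), MetaKGL.baseKernel φ j x x' ≤ 1)
    (Jstar : Finset (Fin p)) (σ c₁ cκ ω : ℝ)
    (hσ : 0 < σ) (hκ : 0 < cκ) (hω : ω ∈ Set.Ioo 0 c₁) :
    -- the finite-sample bound
    (∀ (m n : ℕ), 0 < m → 32 * σ / (min ω (c₁ - ω) * cκ ^ 2) < Real.sqrt (n : ℝ) →
      ∀ (Ω : Type*) [MeasurableSpace Ω] (μ : Measure Ω) (βstar : MetaKGL.Coeff m d)
        (x : Fin m → Fin n → X) (ε : Fin m → Fin n → Ω → ℝ) (βhat : Ω → MetaKGL.Coeff m d),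
        MetaKGL.Setting φ Jstar σ c₁ cκ ω μ βstar x ε βhat →
        1 - (p : ℝ) * Real.exp (-((m : ℝ) / 2) *
            (min ω (c₁ - ω) * cκ ^ 2 * Real.sqrt (n : ℝ) / (32 * σ) - 1) ^ 2)
          ≤ μ.real {w | MetaKGL.selected ω (βhat w) = Jstar}) ∧
    -- consistency in the number `n` of samples per task
    (∀ (m : ℕ), 0 < m →
      ∀ (Ω : ℕ → Type*) [∀ n, MeasurableSpace (Ω n)] (μ : (n : ℕ) → Measure (Ω n))
        (βstar : ℕ → MetaKGL.Coeff m d) (x : (n : ℕ) → Fin m → Fin n → X)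
        (ε : (n : ℕ) → Fin m → Fin n → Ω n → ℝ) (βhat : (n : ℕ) → Ω n → MetaKGL.Coeff m d),
        (∀ᶠ n in atTop,
          MetaKGL.Setting φ Jstar σ c₁ cκ ω (μ n) (βstar n) (x n) (ε n) (βhat n)) →
        Tendsto (fun n => (μ n).real {w | MetaKGL.selected ω (βhat n w) = Jstar})
          atTop (𝓝 1)) ∧
    -- consistency in the number `m` of tasks
    (∀ (n : ℕ), 32 * σ / (min ω (c₁ - ω) * cκ ^ 2) < Real.sqrt (n : ℝ) →
      ∀ (Ω : ℕ → Type*) [∀ m, MeasurableSpace (Ω m)] (μ : (m : ℕ) → Measure (Ω m))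
        (βstar : (m : ℕ) → MetaKGL.Coeff m d) (x : (m : ℕ) → Fin m → Fin n → X)
        (ε : (m : ℕ) → Fin m → Fin n → Ω m → ℝ) (βhat : (m : ℕ) → Ω m → MetaKGL.Coeff m d),
        (∀ᶠ m in atTop,
          MetaKGL.Setting φ Jstar σ c₁ cκ ω (μ m) (βstar m) (x m) (ε m) (βhat m)) →
        Tendsto (fun m => (μ m).real {w | MetaKGL.selected ω (βhat m w) = Jstar})
          atTop (𝓝 1)) := by
  have hω0 : 0 < min ω (c₁ - ω) := lt_min hω.1 (sub_pos.2 hω.2)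
  have hc : 0 < min ω (c₁ - ω) * cκ ^ 2 := by positivity
  refine ⟨fun m n hm hn Ω _ μ βstar x ε βhat h =>
    h.le_measureReal_selected_eq hφ hσ hκ hω hm hn, ?_, ?_⟩
  · intro m hm Ω _ μ βstar x ε βhat h
    have hm' : (0 : ℝ) < m := by exact_mod_cast hm
    have hsqrt : Tendsto (fun n : ℕ => √(n : ℝ)) atTop atTop :=
      Real.tendsto_sqrt_atTop.comp tendsto_natCast_atTop_atTop
    have hexp : Tendsto (fun n : ℕ => 1 - (p : ℝ) * Real.exp (-((m : ℝ) / 2) *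
        (min ω (c₁ - ω) * cκ ^ 2 * √(n : ℝ) / (32 * σ) - 1) ^ 2)) atTop (𝓝 1) := by
      have h1 : Tendsto (fun n : ℕ => min ω (c₁ - ω) * cκ ^ 2 * √(n : ℝ) / (32 * σ) - 1)
          atTop atTop :=
        tendsto_atTop_add_const_right _ _
          ((hsqrt.const_mul_atTop hc).atTop_div_const (by positivity))
      have h2 := Real.tendsto_exp_atBot.comp (((tendsto_pow_atTop two_ne_zero).comp
        h1).const_mul_atTop_of_neg (show -((m : ℝ) / 2) < 0 by linarith))
      simpa [Function.comp_def] using (h2.const_mul (p : ℝ)).const_sub 1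
    refine tendsto_of_tendsto_of_tendsto_of_le_of_le' hexp tendsto_const_nhds ?_ ?_
    · filter_upwards [h, hsqrt.eventually_gt_atTop (32 * σ / (min ω (c₁ - ω) * cκ ^ 2))]
        with n hset hn
      exact hset.le_measureReal_selected_eq hφ hσ hκ hω hm hn
    · filter_upwards [h] with n hset
      have := hset.prob
      exact measureReal_le_one
  · intro n hn Ω _ μ βstar x ε βhat h
    -- For fixed `n` the decay comes from the factor `m` alone, so this base must be nonzero; the
    -- strict lower bound on `√n` ensures it.
    have hr : 0 < min ω (c₁ - ω) * cκ ^ 2 * √(n : ℝ) / (32 * σ) - 1 := by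
      rw [sub_pos, one_lt_div (by positivity)]
      rw [div_lt_iff₀ hc] at hn
      linarith
    have hexp : Tendsto (fun m : ℕ => 1 - (p : ℝ) * Real.exp (-((m : ℝ) / 2) *
        (min ω (c₁ - ω) * cκ ^ 2 * √(n : ℝ) / (32 * σ) - 1) ^ 2)) atTop (𝓝 1) := by
      have h1 : Tendsto (fun m : ℕ => -((m : ℝ) / 2) *
          (min ω (c₁ - ω) * cκ ^ 2 * √(n : ℝ) / (32 * σ) - 1) ^ 2) atTop atBot :=
        (tendsto_neg_atTop_atBot.comp ((tendsto_natCast_atTop_atTop (R := ℝ)).atTop_div_const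
          two_pos)).atBot_mul_const (pow_pos hr 2)
      simpa [Function.comp_def] using
        ((Real.tendsto_exp_atBot.comp h1).const_mul (p : ℝ)).const_sub 1
    refine tendsto_of_tendsto_of_tendsto_of_le_of_le' hexp tendsto_const_nhds ?_ ?_
    · filter_upwards [h, eventually_gt_atTop 0] with m hset hm
      exact hset.le_measureReal_selected_eq hφ hσ hκ hω hm hn
    · filter_upwards [h] with m hset
      have := hset.prob
      exact measureReal_le_one
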